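/- Let $s(n,k)$ denote the (signed) Stirling numbers of the first kind, defined by $\frac{[\ln(1+x)]^k}{k!}=\sum_{n=k}^\infty s(n,k)\frac{x^n}{n!}$ for $|x|<1$, and for integers $k\ge 1$, $m\ge 2$ put $$Q(k,m)=\sum_{\ell=0}^{m}\binom{k+\ell-1}{k-1}\,s(k+m-1,k+\ell-1)\left(\frac{k+m-2}{2}\right)^{\ell}.$$ Then for every integer $k\ge 1$ and every real $x$ with $|x|<1$, $$\left[\frac{(\arccos x)^2}{2(1-x)}\right]^k=1+(2k)!\sum_{n=1}^{\infty}\frac{Q(2k,2n)}{(2k+2n)!}\,[2(x-1)]^n$$ and $$\left[\frac{(\operatorname{arccosh} x)^2}{2(x-1)}\right]^k=1+(2k)!\sum_{n=1}^{\infty}\frac{Q(2k,2n)}{(2k+2n)!}\,[2(x-1)]^n,$$ where the series converges absolutely, and $\operatorname{arccosh} z=\ln\left(z+\sqrt{z+1}\,\sqrt{z-1}\right)$ is the principal branch of the complex inverse hyperbolic cosine. -/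

import Mathlib

/-- The (signed) Stirling numbers of the first kind `s(n, k)`, with
`(log (1 + x)) ^ k / k! = ∑_{n ≥ k} s(n, k) x ^ n / n!`. In terms of the unsigned numbers of
Mathlib (permutations of `n` elements with `k` cycles) the sign is `(-1) ^ (n - k)`, which is
`(-1) ^ (n + k)`. -/
def signedStirlingFirst (n k : ℕ) : ℤ :=
  (-1) ^ (n + k) * (Nat.stirlingFirst n k : ℤ)

/-- `Q(k, m) = ∑_{ℓ = 0}^{m} C(k + ℓ - 1, k - 1) s(k + m - 1, k + ℓ - 1) ((k + m - 2) / 2) ^ ℓ`,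
for `k ≥ 1` and `m ≥ 2` (no natural-number subtraction truncates in this range). -/
noncomputable def stirlingQ (k m : ℕ) : ℝ :=
  ∑ l ∈ Finset.range (m + 1),
    (Nat.choose (k + l - 1) (k - 1) : ℝ) * (signedStirlingFirst (k + m - 1) (k + l - 1) : ℝ)
      * (((k : ℝ) + (m : ℝ) - 2) / 2) ^ l

/-- The principal branch of the inverse hyperbolic cosine,
`arccosh z = log (z + √(z + 1) √(z - 1))`, with principal logarithm and square roots. -/
noncomputable def complexArccosh (z : ℂ) : ℂ :=
  Complex.log (z + Complex.sqrt (z + 1) * Complex.sqrt (z - 1))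

open Polynomial Finset

/-- The coefficients of the falling factorial are the signed Stirling numbers. -/
theorem coeff_descPochhammer_eq_signedStirlingFirst (n k : ℕ) :
    (descPochhammer ℝ n).coeff k = (signedStirlingFirst n k : ℝ) := by
  induction n generalizing k with
  | zero =>
    rcases k with _ | k
    · simp [signedStirlingFirst]
    · simp [signedStirlingFirst, coeff_one]
  | succ n ih =>
    rw [descPochhammer_succ_right, mul_sub, coeff_sub, ← C_eq_natCast, coeff_mul_C]
    rcases k with _ | k
    · rcases n with _ | n <;> simp [ih, signedStirlingFirst]
    · rw [coeff_mul_X, ih, ih]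
      simp only [signedStirlingFirst, Nat.stirlingFirst_succ_succ]
      push_cast
      ring

/-- The polynomial `∏_{j < n} (X - j ^ 2)`, whose coefficients are the central factorial
numbers. -/
noncomputable def centralFactorialPoly (n : ℕ) : ℝ[X] :=
  ∏ j ∈ range n, (X - C ((j : ℝ) ^ 2))

theorem coeff_zero_centralFactorialPoly_succ (n : ℕ) :
    (centralFactorialPoly (n + 1)).coeff 0 = 0 := by
  rw [centralFactorialPoly, prod_range_succ']
  simp

theorem coeff_succ_centralFactorialPoly_succ (n k : ℕ) :
    (centralFactorialPoly (n + 1)).coeff (k + 1) =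
      (centralFactorialPoly n).coeff k - (n : ℝ) ^ 2 * (centralFactorialPoly n).coeff (k + 1) := by
  rw [centralFactorialPoly, prod_range_succ, ← centralFactorialPoly, mul_sub, coeff_sub,
    coeff_mul_X, coeff_mul_C, mul_comm]

theorem coeff_centralFactorialPoly_of_lt {n k : ℕ} (h : n < k) :
    (centralFactorialPoly n).coeff k = 0 := by
  induction n generalizing k with
  | zero => simp [centralFactorialPoly, coeff_one, h.ne']
  | succ n ih =>
    obtain ⟨k, rfl⟩ : ∃ j, k = j + 1 := ⟨k - 1, by omega⟩
    rw [coeff_succ_centralFactorialPoly_succ, ih (by omega), ih (by omega)]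
    simp

theorem coeff_self_centralFactorialPoly (n : ℕ) : (centralFactorialPoly n).coeff n = 1 := by
  induction n with
  | zero => simp [centralFactorialPoly]
  | succ n ih =>
    rw [coeff_succ_centralFactorialPoly_succ, ih, coeff_centralFactorialPoly_of_lt n.lt_succ_self]
    simp

theorem abs_coeff_centralFactorialPoly_le (n k : ℕ) :
    |(centralFactorialPoly n).coeff k| ≤ (n.factorial : ℝ) ^ 2 := by
  induction n generalizing k with
  | zero =>
    simp only [centralFactorialPoly, range_zero, prod_empty, coeff_one]
    split_ifs <;> simp
  | succ n ih =>
    rcases k with _ | k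
    · rw [coeff_zero_centralFactorialPoly_succ, abs_zero]
      positivity
    · rw [coeff_succ_centralFactorialPoly_succ]
      calc _ ≤ |(centralFactorialPoly n).coeff k|
            + |(n : ℝ) ^ 2 * (centralFactorialPoly n).coeff (k + 1)| := abs_sub _ _
        _ ≤ (n.factorial : ℝ) ^ 2 + (n : ℝ) ^ 2 * (n.factorial : ℝ) ^ 2 := by
          rw [abs_mul, abs_of_nonneg (sq_nonneg (n : ℝ))]
          gcongr
          · exact ih k
          · exact ih (k + 1)
        _ ≤ ((n + 1).factorial : ℝ) ^ 2 := by
          rw [Nat.factorial_succ]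
          push_cast
          have : 0 ≤ (n : ℝ) * (n.factorial : ℝ) ^ 2 := by positivity
          nlinarith

/-- The falling factorial of odd length `2a + 1`, centred at `a`, is an even polynomial
divided by `X`. -/
theorem X_mul_descPochhammer_comp (a : ℕ) :
    X * (descPochhammer ℝ (2 * a + 1)).comp (X + C (a : ℝ)) =
      expand ℝ 2 (centralFactorialPoly (a + 1)) := by
  induction a with
  | zero => simp [centralFactorialPoly, sq]
  | succ a ih =>
    have h1 : (descPochhammer ℝ (2 * (a + 1) + 1)).comp (X + C ((a + 1 : ℕ) : ℝ)) =
        (X + C ((a : ℝ) + 1)) * ((descPochhammer ℝ (2 * a + 1)).comp (X + C (a : ℝ)))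
          * (X - C ((a : ℝ) + 1)) := by
      have e : 2 * (a + 1) + 1 = (2 * a + 1 + 1) + 1 := by ring
      have e' : (X - 1 : ℝ[X]).comp (X + C ((a + 1 : ℕ) : ℝ)) = X + C (a : ℝ) := by
        simp [← add_assoc]
      rw [e, descPochhammer_succ_left, descPochhammer_succ_right, mul_comp, comp_assoc, e', mul_comp]
      simp only [X_comp, sub_comp, natCast_comp, map_natCast, map_add, map_one]
      push_cast
      ring
    rw [h1, centralFactorialPoly, prod_range_succ, ← centralFactorialPoly, map_mul, ← ih]
    simp
    ring

theorem stirlingQ_two_mul (k n : ℕ) (hk : 1 ≤ k) (hn : 1 ≤ n) :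
    stirlingQ (2 * k) (2 * n) = (centralFactorialPoly (k + n)).coeff k := by
  obtain ⟨k, rfl⟩ : ∃ j, k = j + 1 := ⟨k - 1, by omega⟩
  set a := k + n with ha
  have h1 : (centralFactorialPoly (k + 1 + n)).coeff (k + 1) =
      ((descPochhammer ℝ (2 * a + 1)).comp (X + C (a : ℝ))).coeff (2 * k + 1) := by
    rw [show k + 1 + n = a + 1 by omega, ← coeff_expand_mul' two_pos, ← X_mul_descPochhammer_comp,
      show 2 * (k + 1) = 2 * k + 1 + 1 by ring, coeff_X_mul]
  have hd : (hasseDeriv (2 * k + 1) (descPochhammer ℝ (2 * a + 1))).natDegree < 2 * n + 1 := by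
    have := natDegree_hasseDeriv_le (descPochhammer ℝ (2 * a + 1)) (2 * k + 1)
    rw [descPochhammer_natDegree] at this
    omega
  rw [h1, ← taylor_apply, taylor_coeff, eval_eq_sum_range' hd, stirlingQ]
  refine sum_congr rfl fun l _ => ?_
  rw [hasseDeriv_coeff, coeff_descPochhammer_eq_signedStirlingFirst,
    show 2 * (k + 1) + l - 1 = l + (2 * k + 1) by omega,
    show 2 * (k + 1) - 1 = 2 * k + 1 by omega,
    show 2 * (k + 1) + 2 * n - 1 = 2 * a + 1 by omega]
  congr 2
  rw [ha]
  push_cast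
  ring

theorem summable_of_coeff_le {b : ℕ → ℝ} {R C : ℝ} {p : ℕ} (hR : 0 < R)
    (hb : ∀ n, |b n| * R ^ n ≤ C * ((n : ℝ) + 1) ^ p) {r : ℝ} (hr0 : 0 ≤ r) (hr : r < R) :
    Summable fun n => |b n| * r ^ n := by
  rcases hr0.eq_or_lt with rfl | hr0
  · exact summable_of_ne_finset_zero (s := {0}) fun n hn => by
      rw [zero_pow (by simpa using hn), mul_zero]
  have hq : ‖r / R‖ < 1 := by
    rw [Real.norm_of_nonneg (by positivity), div_lt_one hR]
    exact hr
  have hs : Summable fun n : ℕ => ((n + 1 : ℕ) : ℝ) ^ p * (r / R) ^ (n + 1) :=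
    (summable_nat_add_iff (f := fun n : ℕ => (n : ℝ) ^ p * (r / R) ^ n) 1).2
      (summable_pow_mul_geometric_of_norm_lt_one p hq)
  refine Summable.of_nonneg_of_le (fun n => by positivity) (fun n => ?_)
    (hs.mul_left (C * (R / r)))
  calc |b n| * r ^ n = |b n| * R ^ n * (r / R) ^ n := by
        rw [div_pow]
        field_simp
    _ ≤ C * ((n : ℝ) + 1) ^ p * (r / R) ^ n :=
        mul_le_mul_of_nonneg_right (hb n) (by positivity)
    _ = C * (R / r) * (((n + 1 : ℕ) : ℝ) ^ p * (r / R) ^ (n + 1)) := by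
        rw [pow_succ (r / R), Nat.cast_succ]
        field_simp

theorem coeff_le_derivative {b : ℕ → ℝ} {R C : ℝ} {p : ℕ} (hR : 0 < R)
    (hb : ∀ n, |b n| * R ^ n ≤ C * ((n : ℝ) + 1) ^ p) (n : ℕ) :
    |((n : ℝ) + 1) * b (n + 1)| * R ^ n ≤ C * 2 ^ p / R * ((n : ℝ) + 1) ^ (p + 1) := by
  have hC : 0 ≤ C := by simpa using (by positivity : 0 ≤ |b 0| * R ^ 0).trans (hb 0)
  have h := hb (n + 1)
  have h2 : (((n + 1 : ℕ) : ℝ) + 1) ^ p ≤ 2 ^ p * ((n : ℝ) + 1) ^ p := by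
    rw [← mul_pow]
    push_cast
    gcongr
    linarith [Nat.cast_nonneg (α := ℝ) n]
  rw [abs_mul, abs_of_nonneg (by positivity : (0 : ℝ) ≤ n + 1)]
  calc _ = ((n : ℝ) + 1) / R * (|b (n + 1)| * R ^ (n + 1)) := by
        rw [pow_succ]
        field_simp
    _ ≤ ((n : ℝ) + 1) / R * (C * (2 ^ p * ((n : ℝ) + 1) ^ p)) := by
        refine mul_le_mul_of_nonneg_left (h.trans ?_) (by positivity)
        exact mul_le_mul_of_nonneg_left h2 hC
    _ = _ := by ring

/-- Termwise differentiation of a real power series whose coefficients are `O(n ^ p / R ^ n)`. -/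
theorem hasDerivAt_tsum_pow {b : ℕ → ℝ} {R C : ℝ} {p : ℕ} (hR : 0 < R)
    (hb : ∀ n, |b n| * R ^ n ≤ C * ((n : ℝ) + 1) ^ p) {v : ℝ} (hv : |v| < R) :
    HasDerivAt (fun v => ∑' n, b n * v ^ n) (∑' n : ℕ, ((n : ℝ) + 1) * b (n + 1) * v ^ n) v := by
  obtain ⟨r, hvr, hr⟩ := exists_between hv
  have hr0 : 0 ≤ r := (abs_nonneg v).trans hvr.le
  have hu : Summable fun n : ℕ => |b n| * n * r ^ (n - 1) := by
    refine (summable_nat_add_iff 1).1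
      ((summable_of_coeff_le hR (coeff_le_derivative hR hb) hr0 hr).congr fun n => ?_)
    rw [abs_mul, abs_of_nonneg (by positivity : (0 : ℝ) ≤ n + 1)]
    rw [Nat.add_sub_cancel, Nat.cast_succ]
    ring
  have h := hasDerivAt_tsum_of_isPreconnected (g := fun n v => b n * v ^ n)
    (g' := fun n v => b n * (n * v ^ (n - 1))) (t := Metric.ball (0 : ℝ) r) (y₀ := 0) (y := v) hu
    Metric.isOpen_ball (convex_ball _ _).isPreconnected
    (fun n y _ => (hasDerivAt_pow n y).const_mul (b n)) (fun n y hy => ?_)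
    (Metric.mem_ball_self ((abs_nonneg v).trans_lt hvr))
    (summable_of_ne_finset_zero (s := {0}) fun n hn => by
      rw [zero_pow (by simpa using hn), mul_zero])
    (by simpa using hvr)
  · have hs : Summable fun n : ℕ => b n * (n * v ^ (n - 1)) := by
      refine Summable.of_norm_bounded hu fun n => ?_
      rw [norm_mul, norm_mul, norm_pow, Real.norm_eq_abs, Real.norm_natCast, Real.norm_eq_abs,
        mul_assoc]
      gcongr
    rw [hs.tsum_eq_zero_add] at h
    simp only [Nat.cast_zero, zero_mul, mul_zero, zero_add, Nat.add_sub_cancel] at h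
    refine h.congr_deriv (tsum_congr fun n => ?_)
    push_cast
    ring
  · have hy : |y| < r := by simpa using hy
    rw [norm_mul, norm_mul, norm_pow, Real.norm_eq_abs, Real.norm_natCast, Real.norm_eq_abs,
      mul_assoc]
    gcongr

/-- The Taylor coefficients of `(-1) ^ k θ ^ (2k) / (2k)!` in powers of `2 cos θ - 2`. -/
noncomputable def arccosCoeff (k n : ℕ) : ℝ :=
  (centralFactorialPoly n).coeff k / ((2 * n).factorial : ℝ)

theorem arccosCoeff_recurrence (k n : ℕ) :
    (2 * (n : ℝ) + 2) * (2 * n + 1) * arccosCoeff (k + 1) (n + 1)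
      + (n : ℝ) ^ 2 * arccosCoeff (k + 1) n = arccosCoeff k n := by
  have h : (((2 * (n + 1)).factorial : ℕ) : ℝ)
      = (2 * (n : ℝ) + 2) * (2 * n + 1) * ((2 * n).factorial : ℝ) := by
    rw [show 2 * (n + 1) = 2 * n + 1 + 1 by ring, Nat.factorial_succ, Nat.factorial_succ]
    push_cast
    ring
  have : ((2 * n).factorial : ℝ) ≠ 0 := by positivity
  rw [arccosCoeff, arccosCoeff, arccosCoeff, coeff_succ_centralFactorialPoly_succ, h]
  field_simp
  ring

theorem arccosCoeff_le (k n : ℕ) :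
    |arccosCoeff k n| * 4 ^ n ≤ 2 * ((n : ℝ) + 1) ^ 1 := by
  have hf : ((2 * n).factorial : ℝ) = Nat.centralBinom n * (n.factorial : ℝ) ^ 2 := by
    have := Nat.choose_mul_factorial_mul_factorial (show n ≤ 2 * n by omega)
    rw [show 2 * n - n = n by omega] at this
    rw [← this, Nat.centralBinom]
    push_cast
    ring
  have hc : (4 : ℝ) ^ n ≤ (2 * n + 1) * Nat.centralBinom n := by
    rcases n.eq_zero_or_pos with rfl | hn
    · simp
    · have := Nat.four_pow_le_two_mul_self_mul_centralBinom n hn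
      have h2 : (4 : ℝ) ^ n ≤ 2 * n * Nat.centralBinom n := by exact_mod_cast this
      have : (0 : ℝ) ≤ Nat.centralBinom n := by positivity
      linarith
  have hb : (0 : ℝ) < Nat.centralBinom n := by exact_mod_cast Nat.centralBinom_pos n
  rw [arccosCoeff, abs_div, abs_of_nonneg (by positivity : (0 : ℝ) ≤ ((2 * n).factorial : ℝ)), hf]
  calc _ ≤ (n.factorial : ℝ) ^ 2 / (Nat.centralBinom n * (n.factorial : ℝ) ^ 2)
        * ((2 * n + 1) * Nat.centralBinom n) := by
        gcongr
        exact abs_coeff_centralFactorialPoly_le n k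
    _ = 2 * n + 1 := by
        have : (n.factorial : ℝ) ≠ 0 := by positivity
        field_simp
    _ ≤ _ := by linarith

theorem summable_arccosCoeff (k : ℕ) {v : ℝ} (hv : |v| < 4) :
    Summable fun n => arccosCoeff k n * v ^ n := by
  refine Summable.of_norm ?_
  simpa [abs_mul, abs_pow] using
    summable_of_coeff_le four_pos (arccosCoeff_le k) (abs_nonneg v) hv

theorem HasSum.mul_pow_shift {b : ℕ → ℝ} {v s : ℝ} (h : HasSum (fun n => b n * v ^ n) s) :
    HasSum (fun n => (if n = 0 then 0 else b (n - 1)) * v ^ n) (v * s) := by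
  rw [← hasSum_nat_add_iff' 1]
  simpa [pow_succ, mul_comm, mul_left_comm, mul_assoc] using h.mul_left v

/-- The differential equation linking consecutive `arccosCoeff` series. -/
theorem tsum_arccosCoeff_ode (k : ℕ) {v : ℝ} (hv : |v| < 4) :
    (4 * v + v ^ 2) * (∑' n : ℕ, ((n : ℝ) + 1) * ((((n + 1 : ℕ) : ℝ) + 1)
          * arccosCoeff (k + 1) (n + 1 + 1)) * v ^ n)
      + (v + 2) * (∑' n : ℕ, ((n : ℝ) + 1) * arccosCoeff (k + 1) (n + 1) * v ^ n)
      = ∑' n, arccosCoeff k n * v ^ n := by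
  have hb := coeff_le_derivative four_pos (arccosCoeff_le (k + 1))
  have hs {b : ℕ → ℝ} {C : ℝ} {p : ℕ} (hb : ∀ n, |b n| * 4 ^ n ≤ C * ((n : ℝ) + 1) ^ p) :
      HasSum (fun n => b n * v ^ n) (∑' n, b n * v ^ n) := by
    refine (Summable.of_norm ?_).hasSum
    simpa [abs_mul, abs_pow] using summable_of_coeff_le four_pos hb (abs_nonneg v) hv
  have h1 := hs hb
  have h2 := hs (coeff_le_derivative four_pos hb)
  have h := (((h2.mul_pow_shift.mul_left 4).add h2.mul_pow_shift.mul_pow_shift).add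
    h1.mul_pow_shift).add (h1.mul_left 2)
  refine Eq.symm ((tsum_congr fun n => ?_).trans (h.tsum_eq.trans ?_))
  · rw [← arccosCoeff_recurrence]
    rcases n with _ | _ | n <;> simp <;> ring
  · ring

theorem tsum_arccosCoeff_zero (v : ℝ) : ∑' n, arccosCoeff 0 n * v ^ n = 1 := by
  rw [tsum_eq_single 0]
  · simp [arccosCoeff, centralFactorialPoly]
  · intro n hn
    obtain ⟨n, rfl⟩ := Nat.exists_eq_succ_of_ne_zero hn
    simp [arccosCoeff, coeff_zero_centralFactorialPoly_succ]

theorem abs_two_mul_cos_sub_two_lt {θ : ℝ} (h : θ ∈ Set.Ioo (-Real.pi) Real.pi) :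
    |2 * Real.cos θ - 2| < 4 := by
  have h1 : -1 < Real.cos θ := by
    rw [← Real.cos_pi, ← Real.cos_abs θ]
    exact Real.cos_lt_cos_of_nonneg_of_le_pi (abs_nonneg _) le_rfl (abs_lt.2 h)
  rw [abs_lt]
  constructor <;> linarith [Real.cos_le_one θ]

theorem Set.EqOn.of_hasDerivAt_two {f f' f'' g g' : ℝ → ℝ} {s : Set ℝ} {x : ℝ} (hs : IsOpen s)
    (hs' : IsPreconnected s) (hf : ∀ y ∈ s, HasDerivAt f (f' y) y)
    (hf' : ∀ y ∈ s, HasDerivAt f' (f'' y) y) (hg : ∀ y ∈ s, HasDerivAt g (g' y) y)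
    (hg' : ∀ y ∈ s, HasDerivAt g' (f'' y) y) (hx : x ∈ s) (h0 : f x = g x) (h1 : f' x = g' x) :
    Set.EqOn f g s := by
  have h : Set.EqOn f' g' s := hs.eqOn_of_deriv_eq hs'
    (fun y hy => (hf' y hy).differentiableAt.differentiableWithinAt)
    (fun y hy => (hg' y hy).differentiableAt.differentiableWithinAt)
    (fun y hy => by rw [(hf' y hy).deriv, (hg' y hy).deriv]) hx h1
  exact hs.eqOn_of_deriv_eq hs'
    (fun y hy => (hf y hy).differentiableAt.differentiableWithinAt)
    (fun y hy => (hg y hy).differentiableAt.differentiableWithinAt)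
    (fun y hy => by rw [(hf y hy).deriv, (hg y hy).deriv, h hy]) hx h0

theorem hasDerivAt_mul_pow_div_factorial (c : ℝ) (m : ℕ) (θ : ℝ) :
    HasDerivAt (fun θ : ℝ => c * θ ^ (m + 1) / ((m + 1).factorial : ℝ))
      (c * θ ^ m / (m.factorial : ℝ)) θ := by
  refine (((hasDerivAt_pow (m + 1) θ).const_mul c).div_const _).congr_deriv ?_
  have : (m.factorial : ℝ) ≠ 0 := by positivity
  rw [Nat.factorial_succ, Nat.add_sub_cancel]
  push_cast
  field_simp

theorem tsum_arccosCoeff_cos (k : ℕ) {θ : ℝ} (hθ : θ ∈ Set.Ioo (-Real.pi) Real.pi) :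
    ∑' n, arccosCoeff k n * (2 * Real.cos θ - 2) ^ n =
      (-1) ^ k * θ ^ (2 * k) / ((2 * k).factorial : ℝ) := by
  induction k generalizing θ with
  | zero => simp [tsum_arccosCoeff_zero]
  | succ k ih =>
    have hv (y : ℝ) : HasDerivAt (fun y => 2 * Real.cos y - 2) (-2 * Real.sin y) y :=
      (((Real.hasDerivAt_cos y).const_mul 2).sub_const 2).congr_deriv (by ring)
    have hb := arccosCoeff_le (k + 1)
    refine Set.EqOn.of_hasDerivAt_two isOpen_Ioo isPreconnected_Ioo
      (f := fun θ => ∑' n, arccosCoeff (k + 1) n * (2 * Real.cos θ - 2) ^ n)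
      (f' := fun θ => (∑' n : ℕ, ((n : ℝ) + 1) * arccosCoeff (k + 1) (n + 1)
        * (2 * Real.cos θ - 2) ^ n) * (-2 * Real.sin θ))
      (f'' := fun θ => (-1) ^ (k + 1) * θ ^ (2 * k) / ((2 * k).factorial : ℝ))
      (fun y hy => (hasDerivAt_tsum_pow four_pos hb
        (abs_two_mul_cos_sub_two_lt hy)).comp (h := fun y => 2 * Real.cos y - 2) y (hv y))
      (fun y hy => ?_)
      (fun y _ => hasDerivAt_mul_pow_div_factorial _ (2 * k + 1) y)
      (fun y _ => hasDerivAt_mul_pow_div_factorial _ (2 * k) y)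
      (x := 0) ⟨neg_lt_zero.2 Real.pi_pos, Real.pi_pos⟩ ?_ ?_ hθ
    · have hy' := abs_two_mul_cos_sub_two_lt hy
      refine (((hasDerivAt_tsum_pow four_pos (coeff_le_derivative four_pos hb) hy').comp
        (h := fun y => 2 * Real.cos y - 2) y (hv y)).mul ((Real.hasDerivAt_sin y).const_mul (-2))).congr_deriv ?_
      have := tsum_arccosCoeff_ode k hy'
      rw [ih hy] at this
      rw [pow_succ, mul_neg_one, neg_mul ((-1 : ℝ) ^ k), neg_div, ← this]
      simp only [Function.comp_apply]
      linear_combination (4 * ∑' n : ℕ, ((n : ℝ) + 1) * ((((n + 1 : ℕ) : ℝ) + 1)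
        * arccosCoeff (k + 1) (n + 1 + 1)) * (2 * Real.cos y - 2) ^ n) * Real.sin_sq_add_cos_sq y
    · simp only [Real.cos_zero]
      rw [tsum_eq_single 0 fun n hn => by norm_num [hn]]
      simp [arccosCoeff, centralFactorialPoly, coeff_one]
    · simp

open scoped ComplexOrder in
theorem complexArccosh_ofReal {x : ℝ} (hx : |x| < 1) :
    complexArccosh x = Real.arccos x * Complex.I := by
  obtain ⟨h1, h2⟩ := abs_lt.1 hx
  have e1 : Complex.sqrt ((x : ℂ) + 1) = (√(x + 1) : ℝ) := by
    rw [Complex.sqrt_of_nonneg (by exact_mod_cast (by linarith : 0 ≤ x + 1))]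
    simp
  have e2 : Complex.sqrt ((x : ℂ) - 1) = Complex.I * (√(1 - x) : ℝ) := by
    have h : (0 : ℂ) ≤ ((1 - x : ℝ) : ℂ) := by exact_mod_cast (by linarith : 0 ≤ 1 - x)
    rw [show (x : ℂ) - 1 = -((1 - x : ℝ) : ℂ) by push_cast; ring,
      Complex.sqrt_neg_of_nonneg h, Complex.sqrt_of_nonneg h, Complex.ofReal_re]
  have e3 : √(x + 1) * √(1 - x) = Real.sin (Real.arccos x) := by
    rw [Real.sin_arccos, ← Real.sqrt_mul (by linarith)]
    ring_nf
  have e4 : (x : ℂ) + Complex.sqrt (x + 1) * Complex.sqrt (x - 1)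
      = Complex.exp (Real.arccos x * Complex.I) := by
    rw [Complex.exp_mul_I, ← Complex.ofReal_cos, ← Complex.ofReal_sin,
      Real.cos_arccos h1.le h2.le, ← e3, e1, e2]
    push_cast
    ring
  have hp := Real.pi_pos
  have h0 := Real.arccos_nonneg x
  rw [complexArccosh, e4, Complex.log_exp]
  · simp only [Complex.im_ofReal_mul, Complex.I_im, mul_one]
    linarith
  · simpa using Real.arccos_le_pi x

theorem hasSum_arccos_pow (k : ℕ) (hk : 1 ≤ k) (x : ℝ) (hx : |x| < 1) :
    HasSum (fun n : ℕ+ =>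
        stirlingQ (2 * k) (2 * n) / ((2 * k + 2 * n).factorial : ℝ) * (2 * (x - 1)) ^ (n : ℕ))
      ((((Real.arccos x) ^ 2 / (2 * (1 - x))) ^ k - 1) / ((2 * k).factorial : ℝ)) := by
  obtain ⟨h1, h2⟩ := abs_lt.1 hx
  set v := 2 * (x - 1) with hv
  have hv0 : v ≠ 0 := by rw [hv]; exact mul_ne_zero two_ne_zero (by linarith)
  have hv4 : |v| < 4 := by rw [abs_lt, hv]; constructor <;> linarith
  have hθ : Real.arccos x ∈ Set.Ioo (-Real.pi) Real.pi := by
    refine ⟨by linarith [Real.arccos_nonneg x, Real.pi_pos], ?_⟩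
    exact lt_of_le_of_ne (Real.arccos_le_pi x) fun h => by
      rw [Real.arccos_eq_pi] at h
      linarith
  have hs := (summable_arccosCoeff k hv4).hasSum
  have hG := tsum_arccosCoeff_cos k hθ
  rw [Real.cos_arccos h1.le h2.le, show 2 * x - 2 = v by rw [hv]; ring] at hG
  rw [hG, ← hasSum_nat_add_iff' k, sum_eq_zero fun i hi => ?_, sub_zero] at hs
  · have hf : ((2 * k).factorial : ℝ) ≠ 0 := by positivity
    have h := (hasSum_nat_add_iff' 1).2 (hs.mul_left (v ^ k)⁻¹)
    refine (hasSum_pnat_iff_hasSum_succ (f := fun n : ℕ => stirlingQ (2 * k) (2 * n)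
      / ((2 * k + 2 * n).factorial : ℝ) * v ^ n)).2 ?_
    have hc : (v ^ k)⁻¹ * ((-1) ^ k * Real.arccos x ^ (2 * k) / ((2 * k).factorial : ℝ))
        - ∑ i ∈ range 1, (v ^ k)⁻¹ * (arccosCoeff k (i + k) * v ^ (i + k))
        = (((Real.arccos x) ^ 2 / (2 * (1 - x))) ^ k - 1) / ((2 * k).factorial : ℝ) := by
      rw [sum_range_one, zero_add, arccosCoeff, coeff_self_centralFactorialPoly,
        show 2 * (1 - x) = -v by rw [hv]; ring, div_pow, neg_pow v, ← pow_mul]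
      have : ((-1 : ℝ) ^ k) * (-1) ^ k = 1 := by rw [← mul_pow]; simp
      field_simp
      linear_combination (Real.arccos x ^ (2 * k)) * this
    rw [← hc]
    refine (congrArg (HasSum · _) (funext fun n => ?_)).mpr h
    have e : 2 * k + 2 * (n + 1) = 2 * (n + 1 + k) := by ring
    rw [stirlingQ_two_mul k (n + 1) hk (by omega), e, add_comm k, arccosCoeff, pow_add]
    field_simp
    ring
  · rw [arccosCoeff, coeff_centralFactorialPoly_of_lt (mem_range.1 hi)]
    simp

theorem theorem4p1 (k : ℕ) (hk : 1 ≤ k) (x : ℝ) (hx : |x| < 1) :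
    (Summable (fun n : ℕ+ =>
        stirlingQ (2 * k) (2 * n) / ((2 * k + 2 * n).factorial : ℝ) * (2 * (x - 1)) ^ (n : ℕ)) ∧
      ((Real.arccos x) ^ 2 / (2 * (1 - x))) ^ k =
        1 + ((2 * k).factorial : ℝ) * ∑' n : ℕ+,
          stirlingQ (2 * k) (2 * n) / ((2 * k + 2 * n).factorial : ℝ)
            * (2 * (x - 1)) ^ (n : ℕ)) ∧
    (Summable (fun n : ℕ+ =>
        (stirlingQ (2 * k) (2 * n) : ℂ) / ((2 * k + 2 * n).factorial : ℂ)
          * (2 * ((x : ℂ) - 1)) ^ (n : ℕ)) ∧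
      ((complexArccosh (x : ℂ)) ^ 2 / (2 * ((x : ℂ) - 1))) ^ k =
        1 + ((2 * k).factorial : ℂ) * ∑' n : ℕ+,
          (stirlingQ (2 * k) (2 * n) : ℂ) / ((2 * k + 2 * n).factorial : ℂ)
            * (2 * ((x : ℂ) - 1)) ^ (n : ℕ)) := by
  have hs := hasSum_arccos_pow k hk x hx
  have hf : ((2 * k).factorial : ℝ) ≠ 0 := by positivity
  have hR : ((Real.arccos x) ^ 2 / (2 * (1 - x))) ^ k =
        1 + ((2 * k).factorial : ℝ) * ∑' n : ℕ+,
          stirlingQ (2 * k) (2 * n) / ((2 * k + 2 * n).factorial : ℝ)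
            * (2 * (x - 1)) ^ (n : ℕ) := by
    rw [hs.tsum_eq]
    field_simp
    ring
  have hc : (complexArccosh (x : ℂ)) ^ 2 / (2 * ((x : ℂ) - 1)) =
      (((Real.arccos x) ^ 2 / (2 * (1 - x)) : ℝ) : ℂ) := by
    rw [complexArccosh_ofReal hx, mul_pow, Complex.I_sq]
    push_cast
    rw [show 2 * ((x : ℂ) - 1) = -(2 * (1 - x)) by ring, mul_neg_one, neg_div_neg_eq]
  refine ⟨⟨hs.summable, hR⟩, ?_, ?_⟩
  · exact_mod_cast Complex.summable_ofReal.2 hs.summable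
  · rw [hc]
    exact_mod_cast congrArg (Complex.ofReal) hR
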